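/- All graphs are finite, simple and undirected. For $n\ge 5$ the chordless cycle $C_n$ is called a hole and its complement $\overline{C_n}$ an antihole; a graph is hole-free (antihole-free) if no induced subgraph of it is isomorphic to a hole (an antihole), and weakly chordal if it is both hole-free and antihole-free. A diamond is $K_4$ minus one edge; the paraglider is the graph on five vertices, four of which induce a diamond while the fifth is adjacent to exactly the two vertices of degree two of the diamond. A clique separator of a graph $G$ is a clique $K$ such that $G-K$ has more connected components than $G$; an atom is a graph without clique separator. A co-matched bipartite graph results from a complete bipartite graph $K_{k,k}$, $k\ge 1$, by deleting a perfect matching, and a matched co-bipartite graph is the complement of a co-matched bipartite graph. $G$ is the join of a matched co-bipartite graph and a clique if $V(G)$ is the disjoint union of sets $H$ and $Q$ such that every vertex of $H$ is adjacent to every vertex of $Q$, $G[H]$ is a matched co-bipartite graph, and $Q$ is a (possibly empty) clique. Let $G$ be a graph that contains no hole and no paraglider as an induced subgraph. Then $G$ has no induced subgraph isomorphic to $\overline{C_n}$ with $n\ge 7$, and the following hold: (i) If $G$ has no induced subgraph isomorphic to $\overline{C_6}$, then $G$ is weakly chordal. (ii) If $G$ is a connected atom that contains an induced $\overline{C_6}$,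 then $G$ is the join of a matched co-bipartite graph and a clique. -/

import Mathlib

namespace HPGraph

open scoped SimpleGraph

universe u

variable {V : Type u}

/-- No induced subgraph of `G` is a hole, i.e. a chordless cycle with at least five vertices.
Here `H ⊴ G` means that some induced subgraph of `G` is isomorphic to `H`. -/
def HoleFree (G : SimpleGraph V) : Prop :=
  ∀ n : ℕ, 5 ≤ n → ¬ (SimpleGraph.cycleGraph n ⊴ G)

/-- No induced subgraph of `G` is an antihole, i.e. the complement of a hole. -/
def AntiholeFree (G : SimpleGraph V) : Prop :=
  ∀ n : ℕ, 5 ≤ n → ¬ ((SimpleGraph.cycleGraph n)ᶜ ⊴ G)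

/-- Weakly chordal graphs. -/
def WeaklyChordal (G : SimpleGraph V) : Prop :=
  HoleFree G ∧ AntiholeFree G

/-- The paraglider: the vertices `0, 1, 2, 3` induce a diamond (a clique on four vertices minus the
edge `23`), and the fifth vertex `4` is adjacent to exactly `2` and `3`. -/
def paraglider : SimpleGraph (Fin 5) :=
  SimpleGraph.fromEdgeSet {s(0, 1), s(0, 2), s(0, 3), s(1, 2), s(1, 3), s(4, 2), s(4, 3)}

/-- No induced subgraph of `G` is a paraglider. -/
def ParagliderFree (G : SimpleGraph V) : Prop :=
  ¬ (paraglider ⊴ G)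

/-- The complement of the chordless cycle on six vertices. -/
def coC6 : SimpleGraph (Fin 6) :=
  (SimpleGraph.cycleGraph 6)ᶜ

/-- `K` is a clique separator of `G`: a clique such that `G - K` has more connected components
than `G`. -/
def IsCliqueSeparator (G : SimpleGraph V) (K : Set V) : Prop :=
  G.IsClique K ∧
    ENat.card G.ConnectedComponent < ENat.card (G.induce Kᶜ).ConnectedComponent

/-- An atom is a graph without clique separator. -/
def IsAtomGraph (G : SimpleGraph V) : Prop :=
  ¬ ∃ K : Set V, IsCliqueSeparator G K

/-- The co-matched bipartite graph: `K_{k,k}` with the edges of a perfect matching deleted. -/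
def coMatchedBipartiteGraph (k : ℕ) : SimpleGraph (Fin k ⊕ Fin k) :=
  (completeBipartiteGraph (Fin k) (Fin k)).deleteEdges
    (Set.range fun i : Fin k => s(Sum.inl i, Sum.inr i))

/-- `G` is (isomorphic to) the complement of a co-matched bipartite graph. -/
def IsMatchedCoBipartite (G : SimpleGraph V) : Prop :=
  ∃ k : ℕ, 1 ≤ k ∧ Nonempty (G ≃g (coMatchedBipartiteGraph k)ᶜ)

/-- `G` is the join of a matched co-bipartite graph and a (possibly empty) clique. -/
def IsJoinOfMatchedCoBipartiteAndClique (G : SimpleGraph V) : Prop :=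
  ∃ H Q : Set V, Disjoint H Q ∧ H ∪ Q = Set.univ ∧
    (∀ x ∈ H, ∀ y ∈ Q, G.Adj x y) ∧
    IsMatchedCoBipartite (G.induce H) ∧ G.IsClique Q

end HPGraph

/-! An antihole on at least seven vertices contains a paraglider, and the five-antihole is a hole;
only the complement of `C₆` can survive, which gives (i).

For (ii), that complement is a matched pair with `k = 3`; take a matched pair that cannot be
extended. A vertex outside it that sees two nonadjacent vertices of it sees all of it
(`IsMatchedPair.adj_of_adj_of_adj`), and the vertices that see all of it form a clique
(`IsMatchedPair.adj_of_complete`). Suppose that a component of the remaining vertices sees two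
nonadjacent vertices of the pair. A shortest path witnessing this closes to a hole through the pair
unless it is a single edge that enlarges the pair (`IsMatchedPair.exists_larger`). Hence the
neighbourhood of such a component is a clique, which cuts it off from part of the pair. In an atom
no such component exists, so the graph is the pair joined to a clique. -/

namespace HPGraph

open scoped SimpleGraph

/-! ### Adjacency in cycles. -/

section CycleGraph

theorem cycleGraph_adj_val {n : ℕ} (hn : 3 ≤ n) (u v : Fin n) :
    (SimpleGraph.cycleGraph n).Adj u v ↔
      u.val + 1 = v.val ∨ v.val + 1 = u.val ∨ (u.val = 0 ∧ v.val + 1 = n) ∨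
        (v.val = 0 ∧ u.val + 1 = n) := by
  rw [SimpleGraph.cycleGraph_adj']
  have hu := u.isLt
  have hv := v.isLt
  rcases lt_trichotomy u v with h | h | h
  · have h' : u.val < v.val := h
    rw [Fin.coe_sub_iff_lt.2 h, Fin.coe_sub_iff_le.2 h.le]
    omega
  · subst h
    rw [Fin.coe_sub_iff_le.2 le_rfl]
    omega
  · have h' : v.val < u.val := h
    rw [Fin.coe_sub_iff_lt.2 h, Fin.coe_sub_iff_le.2 h.le]
    omega

theorem cycleGraph_five_isIndContained_compl :
    SimpleGraph.cycleGraph 5 ⊴ (SimpleGraph.cycleGraph 5)ᶜ :=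
  -- Doubling modulo 5 turns differences `±1` into `±2`.
  ⟨⟨⟨fun i => 2 * i, by decide⟩, by
    intro i j
    change (SimpleGraph.cycleGraph 5)ᶜ.Adj (2 * i) (2 * j) ↔ _
    rw [SimpleGraph.compl_adj, SimpleGraph.cycleGraph_adj, SimpleGraph.cycleGraph_adj]
    revert i j
    decide⟩⟩

end CycleGraph

/-! ### Induced paths, forbidden configurations and antiholes. -/

variable {V : Type*} {G : SimpleGraph V}

/-- The vertices `p 0, …, p (n - 1)` form an induced path of `G`, in this order. -/
def IsInducedPath (G : SimpleGraph V) (n : ℕ) (p : ℕ → V) : Prop :=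
  ∀ i j, i < j → j < n → p i ≠ p j ∧ (G.Adj (p i) (p j) ↔ j = i + 1)

/-- Only the first values of `p` matter, so a vertex is appended by overwriting the next one. -/
theorem IsInducedPath.snoc {n : ℕ} {p : ℕ → V} (hp : IsInducedPath G (n + 1) p) {v : V}
    (hadj : G.Adj (p n) v) (hne : ∀ i ≤ n, p i ≠ v) (hnadj : ∀ i < n, ¬ G.Adj (p i) v) :
    IsInducedPath G (n + 2) (Function.update p (n + 1) v) := by
  intro i j hij hj
  rw [Function.update_of_ne (by omega : i ≠ n + 1)]
  rcases Nat.lt_or_ge j (n + 1) with h | h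
  · rw [Function.update_of_ne (by omega : j ≠ n + 1)]
    exact hp i j hij h
  · obtain rfl : j = n + 1 := by omega
    rw [Function.update_self]
    refine ⟨hne i (by omega), ?_⟩
    rcases Nat.lt_or_ge i n with h' | h'
    · simp only [hnadj i h', false_iff]
      omega
    · obtain rfl : i = n := by omega
      simp [hadj]

/-- The closed cycle has `n + 2` vertices, so `3 ≤ n` is what makes it a hole. -/
theorem HoleFree.not_closes_inducedPath (hG : HoleFree G) {n : ℕ} {p : ℕ → V}
    (hn : 3 ≤ n) (hp : IsInducedPath G (n + 1) p) {v : V} (h0 : G.Adj (p 0) v)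
    (hlast : G.Adj (p n) v) (hne : ∀ i ≤ n, p i ≠ v)
    (hnadj : ∀ i, 0 < i → i < n → ¬ G.Adj (p i) v) : False := by
  set q := Function.update p (n + 1) v with hq
  have key : ∀ i j, i < j → j < n + 2 →
      q i ≠ q j ∧ (G.Adj (q i) (q j) ↔ j = i + 1 ∨ (i = 0 ∧ j = n + 1)) := by
    intro i j hij hj
    rw [hq, Function.update_of_ne (by omega : i ≠ n + 1)]
    rcases Nat.lt_or_ge j (n + 1) with h | h
    · rw [Function.update_of_ne (by omega : j ≠ n + 1)]
      refine ⟨(hp i j hij h).1, (hp i j hij h).2.trans ?_⟩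
      omega
    · obtain rfl : j = n + 1 := by omega
      rw [Function.update_self]
      refine ⟨hne i (by omega), ?_⟩
      rcases Nat.eq_zero_or_pos i with rfl | hi
      · simp [h0]
      rcases Nat.lt_or_ge i n with h' | h'
      · simp only [hnadj i hi h', false_iff]
        omega
      · obtain rfl : i = n := by omega
        simp [hlast]
  refine hG (n + 2) (by omega) ⟨⟨⟨fun i => q i.val, ?_⟩, ?_⟩⟩
  · intro i j hij
    rcases lt_trichotomy i j with h | h | h
    · exact absurd hij (key _ _ h j.isLt).1
    · exact h
    · exact absurd hij.symm (key _ _ h i.isLt).1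
  · intro i j
    change G.Adj (q i.val) (q j.val) ↔ _
    rw [cycleGraph_adj_val (by omega)]
    have hi := i.isLt
    have hj := j.isLt
    rcases lt_trichotomy i j with h | h | h
    · have h' : i.val < j.val := h
      rw [(key _ _ h j.isLt).2]
      omega
    · subst h
      simp only [SimpleGraph.irrefl, false_iff]
      omega
    · have h' : j.val < i.val := h
      rw [G.adj_comm, (key _ _ h i.isLt).2]
      omega

theorem isInducedPath_two {u v : V} (h : G.Adj u v) :
    IsInducedPath G 2 (Function.update (fun _ => u) 1 v) := by
  intro i j hij hj
  obtain rfl : i = 0 := by omega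
  obtain rfl : j = 1 := by omega
  simp [h, h.ne]

/-- A hole-free graph has no chordless five-cycle `v₀ v₁ v₂ v₃ v₄`. -/
theorem HoleFree.not_five_cycle (hG : HoleFree G) {v₀ v₁ v₂ v₃ v₄ : V}
    (h01 : G.Adj v₀ v₁) (h12 : G.Adj v₁ v₂) (h23 : G.Adj v₂ v₃) (h34 : G.Adj v₃ v₄)
    (h40 : G.Adj v₄ v₀) (h02 : ¬ G.Adj v₀ v₂) (h13 : ¬ G.Adj v₁ v₃) (h24 : ¬ G.Adj v₂ v₄)
    (h30 : ¬ G.Adj v₃ v₀) (h41 : ¬ G.Adj v₄ v₁) : False := by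
  have n02 : v₀ ≠ v₂ := by rintro rfl; exact h30 h23.symm
  have n13 : v₁ ≠ v₃ := by rintro rfl; exact h41 h34.symm
  have n24 : v₂ ≠ v₄ := by rintro rfl; exact h02 h40.symm
  have n30 : v₃ ≠ v₀ := by rintro rfl; exact h13 h01.symm
  have n41 : v₄ ≠ v₁ := by rintro rfl; exact h24 h12.symm
  have p2 := isInducedPath_two h01
  have p3 := p2.snoc (v := v₂) (by simpa using h12)
    (by intro i hi; interval_cases i <;> simp [n02, h12.ne])
    (by intro i hi; interval_cases i; simpa using h02)
  have p4 := p3.snoc (v := v₃) (by simpa using h23)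
    (by intro i hi; interval_cases i <;> simp [n30.symm, n13, h23.ne])
    (by intro i hi; interval_cases i <;> simp [h13, G.adj_comm v₀, h30])
  exact hG.not_closes_inducedPath (v := v₄) le_rfl p4 (by simpa using h40.symm)
    (by simpa using h34)
    (by intro i hi; interval_cases i <;> simp [n24, n41.symm, h34.ne, h40.ne.symm])
    (by intro i hi hi'; interval_cases i <;> simp [h24, G.adj_comm v₁, h41])

/-- In a paraglider-free graph, the common neighbours of two nonadjacent vertices induce no
edge plus isolated vertex. -/
theorem ParagliderFree.adj_or_adj (hG : ParagliderFree G) {r s p q t : V} (hne : r ≠ s)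
    (hrs : ¬ G.Adj r s) (hpq : G.Adj p q) (hrp : G.Adj r p) (hrq : G.Adj r q) (hrt : G.Adj r t)
    (hsp : G.Adj s p) (hsq : G.Adj s q) (hst : G.Adj s t) : G.Adj t p ∨ G.Adj t q := by
  by_contra! h
  obtain ⟨htp, htq⟩ := h
  have ntp : t ≠ p := by rintro rfl; exact htq hpq
  have ntq : t ≠ q := by rintro rfl; exact htp hpq.symm
  have e : ∀ i j : Fin 5, i < j → (![p, q, r, s, t] i ≠ ![p, q, r, s, t] j ∧
      (G.Adj (![p, q, r, s, t] i) (![p, q, r, s, t] j) ↔ paraglider.Adj i j)) := by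
    intro i j hij
    fin_cases i <;> fin_cases j <;> first | (exact absurd hij (by decide)) | skip
    all_goals simp [paraglider, hne, hrs, hpq, hpq.ne, hrp.symm, hrp.ne.symm, hrq.symm,
      hrq.ne.symm, hrt, hrt.ne, hsp.symm, hsp.ne.symm, hsq.symm, hsq.ne.symm, hst, hst.ne,
      ntp.symm, ntq.symm, G.adj_comm p t, htp, G.adj_comm q t, htq]
  refine hG ⟨⟨⟨![p, q, r, s, t], ?_⟩, ?_⟩⟩
  · intro i j hij
    rcases lt_trichotomy i j with h | h | h
    · exact absurd hij (e _ _ h).1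
    · exact h
    · exact absurd hij.symm (e _ _ h).1
  · intro i j
    change G.Adj (![p, q, r, s, t] i) (![p, q, r, s, t] j) ↔ _
    rcases lt_trichotomy i j with h | h | h
    · exact (e _ _ h).2
    · subst h; simp
    · rw [G.adj_comm, (e _ _ h).2, SimpleGraph.adj_comm]

theorem ParagliderFree.not_isIndContained_antihole (hG : ParagliderFree G) {n : ℕ} (hn : 7 ≤ n) :
    ¬ ((SimpleGraph.cycleGraph n)ᶜ ⊴ G) := by
  rintro ⟨f⟩
  have hf : ∀ (i j : ℕ) (hi : i < n) (hj : j < n), G.Adj (f ⟨i, hi⟩) (f ⟨j, hj⟩) ↔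
      i ≠ j ∧ ¬ (i + 1 = j ∨ j + 1 = i ∨ (i = 0 ∧ j + 1 = n) ∨ (j = 0 ∧ i + 1 = n)) := by
    intro i j hi hj
    rw [f.map_adj_iff, SimpleGraph.compl_adj, cycleGraph_adj_val (by omega), Ne, Fin.mk.injEq]
  -- For `n ≥ 7` neither 4 nor 5 is next to 0, 1 or 2 on the cycle. In the complement they are
  -- nonadjacent with common neighbours 0, 1, 2, among which only 0 and 2 are adjacent.
  have key := hG.adj_or_adj (r := f ⟨4, by omega⟩) (s := f ⟨5, by omega⟩) (p := f ⟨0, by omega⟩)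
    (q := f ⟨2, by omega⟩) (t := f ⟨1, by omega⟩) (by simp) (by rw [hf]; omega)
    (by rw [hf]; omega) (by rw [hf]; omega) (by rw [hf]; omega) (by rw [hf]; omega)
    (by rw [hf]; omega) (by rw [hf]; omega) (by rw [hf]; omega)
  rw [hf, hf] at key
  omega

theorem weaklyChordal_of_not_isIndContained_coC6 (hhole : HoleFree G) (hpara : ParagliderFree G)
    (h6 : ¬ (coC6 ⊴ G)) : WeaklyChordal G := by
  refine ⟨hhole, fun n hn h => ?_⟩
  rcases Nat.lt_or_ge n 7 with h7 | h7
  · interval_cases n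
    · exact hhole 5 le_rfl (cycleGraph_five_isIndContained_compl.trans h)
    · exact h6 h
  · exact hpara.not_isIndContained_antihole h7 h

/-! ### Closing an induced path through further vertices; geodesics. -/

section InducedPath

/-- This lemma and the next two close a path with `d` edges by one, two or three vertices followed
by `u`. The cycles have `d + 3`, `d + 4` and `d + 5` vertices, whence the lower bounds on `d`. Later
`u` and most of the added vertices run through a matched pair. -/
theorem IsInducedPath.not_closes_one (hG : HoleFree G) {d : ℕ} {p : ℕ → V} (hd : 2 ≤ d)
    (hp : IsInducedPath G (d + 1) p) {w u : V} (hw : G.Adj (p d) w) (hwu : G.Adj w u)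
    (hu : G.Adj (p 0) u) (hpw : ∀ t ≤ d, p t ≠ w) (hpu : ∀ t ≤ d, p t ≠ u)
    (hw' : ∀ t < d, ¬ G.Adj (p t) w) (hu' : ∀ t, 0 < t → t ≤ d → ¬ G.Adj (p t) u) : False := by
  refine hG.not_closes_inducedPath (by omega) (hp.snoc hw hpw hw') (v := u) ?_ ?_ ?_ ?_
  · rwa [Function.update_of_ne (by omega)]
  · rwa [Function.update_self]
  · intro i hi
    rcases hi.eq_or_lt with rfl | h
    · rw [Function.update_self]
      exact hwu.ne
    · rw [Function.update_of_ne h.ne]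
      exact hpu i (by omega)
  · intro i h0 h
    rw [Function.update_of_ne h.ne]
    exact hu' i h0 (by omega)

theorem IsInducedPath.not_closes_two (hG : HoleFree G) {d : ℕ} {p : ℕ → V} (hd : 1 ≤ d)
    (hp : IsInducedPath G (d + 1) p) {w₁ w₂ u : V} (hw : G.Adj (p d) w₁) (hww : G.Adj w₁ w₂)
    (hwu : G.Adj w₂ u) (hu : G.Adj (p 0) u) (hpw₁ : ∀ t ≤ d, p t ≠ w₁)
    (hpw₂ : ∀ t ≤ d, p t ≠ w₂) (hpu : ∀ t ≤ d, p t ≠ u) (hw₁u : ¬ G.Adj w₁ u)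
    (hw₁ : ∀ t < d, ¬ G.Adj (p t) w₁) (hw₂ : ∀ t ≤ d, ¬ G.Adj (p t) w₂)
    (hu' : ∀ t, 0 < t → t ≤ d → ¬ G.Adj (p t) u) : False := by
  have hne : w₁ ≠ u := by
    rintro rfl
    exact hu' d (by omega) le_rfl hw
  refine (hp.snoc hw hpw₁ hw₁).not_closes_one hG (by omega) (w := w₂) (u := u) ?_ hwu ?_ ?_ ?_ ?_ ?_
  · rwa [Function.update_self]
  · rwa [Function.update_of_ne (by omega)]
  · intro i hi
    rcases hi.eq_or_lt with rfl | h
    · rw [Function.update_self]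
      exact hww.ne
    · rw [Function.update_of_ne h.ne]
      exact hpw₂ i (by omega)
  · intro i hi
    rcases hi.eq_or_lt with rfl | h
    · rwa [Function.update_self]
    · rw [Function.update_of_ne h.ne]
      exact hpu i (by omega)
  · intro i h
    rw [Function.update_of_ne h.ne]
    exact hw₂ i (by omega)
  · intro i h0 hi
    rcases hi.eq_or_lt with rfl | h
    · rwa [Function.update_self]
    · rw [Function.update_of_ne h.ne]
      exact hu' i h0 (by omega)

theorem IsInducedPath.not_closes_three (hG : HoleFree G) {d : ℕ} {p : ℕ → V} (hd : 1 ≤ d)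
    (hp : IsInducedPath G (d + 1) p) {w₁ w₂ w₃ u : V} (hw : G.Adj (p d) w₁)
    (hw12 : G.Adj w₁ w₂) (hw23 : G.Adj w₂ w₃) (hwu : G.Adj w₃ u) (hu : G.Adj (p 0) u)
    (hpw₁ : ∀ t ≤ d, p t ≠ w₁) (hpw₂ : ∀ t ≤ d, p t ≠ w₂) (hpw₃ : ∀ t ≤ d, p t ≠ w₃)
    (hpu : ∀ t ≤ d, p t ≠ u) (hw₁u : ¬ G.Adj w₁ u) (hw₂u : ¬ G.Adj w₂ u)
    (hw13 : ¬ G.Adj w₁ w₃) (hw₁ : ∀ t < d, ¬ G.Adj (p t) w₁)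
    (hw₂ : ∀ t ≤ d, ¬ G.Adj (p t) w₂) (hw₃ : ∀ t ≤ d, ¬ G.Adj (p t) w₃)
    (hu' : ∀ t, 0 < t → t ≤ d → ¬ G.Adj (p t) u) : False := by
  have hne : w₁ ≠ u := by
    rintro rfl
    exact hu' d (by omega) le_rfl hw
  have hne' : w₁ ≠ w₃ := by
    rintro rfl
    exact hw₃ d le_rfl hw
  refine (hp.snoc hw hpw₁ hw₁).not_closes_two hG (by omega) (w₁ := w₂) (w₂ := w₃) (u := u)
    ?_ hw23 hwu ?_ ?_ ?_ ?_ hw₂u ?_ ?_ ?_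
  · rwa [Function.update_self]
  · rwa [Function.update_of_ne (by omega)]
  · intro i hi
    rcases hi.eq_or_lt with rfl | h
    · rw [Function.update_self]
      exact hw12.ne
    · rw [Function.update_of_ne h.ne]
      exact hpw₂ i (by omega)
  · intro i hi
    rcases hi.eq_or_lt with rfl | h
    · rwa [Function.update_self]
    · rw [Function.update_of_ne h.ne]
      exact hpw₃ i (by omega)
  · intro i hi
    rcases hi.eq_or_lt with rfl | h
    · rwa [Function.update_self]
    · rw [Function.update_of_ne h.ne]
      exact hpu i (by omega)
  · intro i h
    rw [Function.update_of_ne h.ne]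
    exact hw₂ i (by omega)
  · intro i hi
    rcases hi.eq_or_lt with rfl | h
    · rwa [Function.update_self]
    · rw [Function.update_of_ne h.ne]
      exact hw₃ i (by omega)
  · intro i h0 hi
    rcases hi.eq_or_lt with rfl | h
    · rwa [Function.update_self]
    · rw [Function.update_of_ne h.ne]
      exact hu' i h0 (by omega)

theorem exists_geodesic {x y : V} (h : G.Reachable x y) :
    ∃ q : ℕ → V, q 0 = x ∧ q (G.dist x y) = y ∧ IsInducedPath G (G.dist x y + 1) q ∧
      ∀ s t, s ≤ t → t ≤ G.dist x y → G.Reachable (q s) (q t) ∧ G.dist (q s) (q t) = t - s := by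
  obtain ⟨w, hw⟩ := h.exists_walk_length_eq_dist
  have walks : ∀ s n, s + n ≤ G.dist x y →
      ∃ w' : G.Walk (w.getVert s) (w.getVert (s + n)), w'.length = n := by
    intro s n
    induction n with
    | zero => exact fun _ => ⟨.nil, rfl⟩
    | succ n ih =>
      intro hn
      obtain ⟨w', hw'⟩ := ih (by omega)
      exact ⟨w'.concat (w.adj_getVert_succ (by omega)), by simp [hw']⟩
  have hd : ∀ s t, s ≤ t → t ≤ G.dist x y →
      G.Reachable (w.getVert s) (w.getVert t) ∧
        G.dist (w.getVert s) (w.getVert t) = t - s := by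
    intro s t hst ht
    obtain ⟨n, rfl⟩ := Nat.exists_eq_add_of_le hst
    obtain ⟨w', hw'⟩ := walks s n ht
    refine ⟨w'.reachable, ?_⟩
    have hle := SimpleGraph.dist_le w'
    obtain ⟨w'', hw''⟩ := w'.reachable.exists_walk_length_eq_dist
    -- A shortcut between two vertices of a shortest walk would shorten the whole walk.
    have := SimpleGraph.dist_le (((w.take s).append w'').append (w.drop (s + n)))
    simp only [SimpleGraph.Walk.length_append, SimpleGraph.Walk.take_length,
      SimpleGraph.Walk.drop_length] at this
    omega
  refine ⟨w.getVert, w.getVert_zero, by rw [← hw, w.getVert_length], ?_, hd⟩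
  intro i j hij hj
  obtain ⟨-, h⟩ := hd i j hij.le (by omega)
  constructor
  · intro he
    rw [he, SimpleGraph.dist_self] at h
    omega
  · rw [← SimpleGraph.dist_eq_one_iff_adj, h]
    omega

end InducedPath

/-! ### Matched pairs and single vertices attached to them. -/

section MatchedPair

/-- The vertices `a i`, `b i` induce a matched co-bipartite graph: `a` and `b` enumerate cliques,
and `a i`, `b j` are adjacent exactly when `i = j`. -/
structure IsMatchedPair (G : SimpleGraph V) {k : ℕ} (a b : Fin k → V) : Prop where
  adj_left : ∀ {i j}, i ≠ j → G.Adj (a i) (a j)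
  adj_right : ∀ {i j}, i ≠ j → G.Adj (b i) (b j)
  ne : ∀ i j, a i ≠ b j
  adj : ∀ i, G.Adj (a i) (b i)
  not_adj : ∀ {i j}, i ≠ j → ¬ G.Adj (a i) (b j)

variable {k : ℕ} {a b : Fin k → V}

theorem IsMatchedPair.swap (M : IsMatchedPair G a b) : IsMatchedPair G b a where
  adj_left := M.adj_right
  adj_right := M.adj_left
  ne i j := (M.ne j i).symm
  adj i := (M.adj i).symm
  not_adj h h' := M.not_adj h.symm h'.symm

theorem IsMatchedPair.not_adj' (M : IsMatchedPair G a b) {i j : Fin k} (h : i ≠ j) :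
    ¬ G.Adj (b i) (a j) := M.swap.not_adj h

theorem exists_ne_ne (hk : 3 ≤ k) (i j : Fin k) : ∃ l, l ≠ i ∧ l ≠ j := by
  by_contra! h
  have : (Finset.univ : Finset (Fin k)) ⊆ {i, j} := by
    intro l _
    by_cases hl : l = i
    · simp [hl]
    · simp [h l hl]
  have := Finset.card_le_card this
  have := Finset.card_le_two (a := i) (b := j)
  simp at *
  omega

/-- The nonadjacent vertices `a i`, `b j` have common neighbours `x`, `a j`, `b i`; the edge from
`x` to `a j` forces `b i` to see `x`, as it misses `a j`. -/
theorem IsMatchedPair.adj_of_adj (hpara : ParagliderFree G) (M : IsMatchedPair G a b) {x : V}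
    {i j : Fin k} (hij : i ≠ j) (hi : G.Adj x (a i)) (hj : G.Adj x (b j)) (h : G.Adj x (a j)) :
    G.Adj x (b i) := by
  have := hpara.adj_or_adj (r := a i) (s := b j) (p := x) (q := a j) (t := b i) (M.ne i j)
    (M.not_adj hij) h hi.symm (M.adj_left hij) (M.adj i) hj.symm (M.adj j).symm
    (M.adj_right hij.symm)
  exact (this.resolve_right (M.not_adj' hij)).symm

/-- Otherwise `x` misses `a j` and `b i`. For a third index `l`, paragliders prevent `x` from seeing
`a l` or `b l`, and then `x, a i, a l, b l, b j` is a hole. -/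
theorem IsMatchedPair.adj_left_of_adj (hhole : HoleFree G) (hpara : ParagliderFree G) (hk : 3 ≤ k)
    (M : IsMatchedPair G a b) {x : V} (hxa : ∀ i, x ≠ a i) (hxb : ∀ i, x ≠ b i) {i j : Fin k}
    (hij : i ≠ j) (hi : G.Adj x (a i)) (hj : G.Adj x (b j)) : G.Adj x (a j) := by
  by_contra h
  have h' : ¬ G.Adj x (b i) := fun h' => h (M.swap.adj_of_adj hpara hij.symm hj hi h')
  obtain ⟨l, hli, hlj⟩ := exists_ne_ne hk i j
  have hla : ¬ G.Adj x (a l) := fun hl => by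
    have := hpara.adj_or_adj (r := x) (s := a j) (p := a i) (q := a l) (t := b j) (hxa j) h
      (M.adj_left hli.symm) hi hl hj (M.adj_left hij.symm) (M.adj_left hlj.symm) (M.adj j)
    exact this.elim (M.not_adj' hij.symm) (M.not_adj' hlj.symm)
  have hlb : ¬ G.Adj x (b l) := fun hl => by
    have := hpara.adj_or_adj (r := x) (s := b i) (p := b j) (q := b l) (t := a i) (hxb i) h'
      (M.adj_right hlj.symm) hj hl hi (M.adj_right hij) (M.adj_right hli.symm) (M.adj i).symm
    exact this.elim (M.not_adj hij) (M.not_adj hli.symm)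
  exact hhole.not_five_cycle hi (M.adj_left hli.symm) (M.adj l) (M.adj_right hlj) hj.symm
    hla (M.not_adj hli.symm) (M.not_adj hlj) (fun h => hlb h.symm) (M.not_adj' hij.symm)

/-- A vertex outside a matched pair that sees two nonadjacent vertices of it sees all of it. -/
theorem IsMatchedPair.adj_of_adj_of_adj (hhole : HoleFree G) (hpara : ParagliderFree G)
    (hk : 3 ≤ k) (M : IsMatchedPair G a b) {x : V} (hxa : ∀ i, x ≠ a i) (hxb : ∀ i, x ≠ b i)
    {i j : Fin k} (hij : i ≠ j) (hi : G.Adj x (a i)) (hj : G.Adj x (b j)) (l : Fin k) :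
    G.Adj x (a l) ∧ G.Adj x (b l) := by
  have hja := M.adj_left_of_adj hhole hpara hk hxa hxb hij hi hj
  have hib := M.adj_of_adj hpara hij hi hj hja
  by_cases hli : l = i
  · exact hli ▸ ⟨hi, hib⟩
  by_cases hlj : l = j
  · exact hlj ▸ ⟨hja, hj⟩
  have hab : G.Adj x (a l) → G.Adj x (b l) := fun h => M.adj_of_adj hpara hli h hib hi
  have hba : G.Adj x (b l) → G.Adj x (a l) := fun h => M.swap.adj_of_adj hpara hli h hi hib
  by_cases hla : G.Adj x (a l)
  · exact ⟨hla, hab hla⟩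
  have hlb : ¬ G.Adj x (b l) := fun h => hla (hba h)
  exact (hhole.not_five_cycle (M.adj_left hlj) hja.symm hib (M.adj_right (Ne.symm hli))
    (M.adj l).symm (fun h => hla h.symm) (M.not_adj (Ne.symm hij)) hlb (M.not_adj' (Ne.symm hli))
    (M.not_adj' hlj)).elim

/-- The vertex set of a matched pair. -/
def pairSet (a b : Fin k → V) : Set V := Set.range a ∪ Set.range b

theorem left_mem_pairSet (i : Fin k) : a i ∈ pairSet a b := Or.inl ⟨i, rfl⟩

theorem right_mem_pairSet (i : Fin k) : b i ∈ pairSet a b := Or.inr ⟨i, rfl⟩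

theorem pairSet_comm (a b : Fin k → V) : pairSet a b = pairSet b a := Set.union_comm _ _

/-- The vertices outside `pairSet a b` that are not complete to it. -/
def outerSet (G : SimpleGraph V) (a b : Fin k → V) : Set V :=
  {x | x ∉ pairSet a b ∧ ¬ ∀ h ∈ pairSet a b, G.Adj x h}

theorem IsMatchedPair.not_adj_of_mem_outerSet (hhole : HoleFree G) (hpara : ParagliderFree G)
    (hk : 3 ≤ k) (M : IsMatchedPair G a b) {x : V} (hx : x ∈ outerSet G a b) {i j : Fin k}
    (hij : i ≠ j) (hi : G.Adj x (a i)) : ¬ G.Adj x (b j) := by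
  intro hj
  have key := M.adj_of_adj_of_adj hhole hpara hk (x := x)
    (fun l h => hx.1 (h ▸ left_mem_pairSet l)) (fun l h => hx.1 (h ▸ right_mem_pairSet l)) hij hi hj
  refine hx.2 ?_
  rintro _ (⟨l, rfl⟩ | ⟨l, rfl⟩)
  exacts [(key l).1, (key l).2]

/-- Two distinct nonadjacent vertices of a matched pair lie on different sides of it. -/
theorem IsMatchedPair.exists_of_not_adj (M : IsMatchedPair G a b) {u v : V}
    (hu : u ∈ pairSet a b) (hv : v ∈ pairSet a b) (hne : u ≠ v) (huv : ¬ G.Adj u v) :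
    ∃ i j, i ≠ j ∧ ((u = a i ∧ v = b j) ∨ (u = b i ∧ v = a j)) := by
  rcases hu with ⟨i, rfl⟩ | ⟨i, rfl⟩ <;> rcases hv with ⟨j, rfl⟩ | ⟨j, rfl⟩
  · exact (huv (M.adj_left fun h => hne (h ▸ rfl))).elim
  · exact ⟨i, j, fun h => huv (h ▸ M.adj i), Or.inl ⟨rfl, rfl⟩⟩
  · exact ⟨i, j, fun h => huv (h ▸ (M.adj i).symm), Or.inr ⟨rfl, rfl⟩⟩
  · exact (huv (M.adj_right fun h => hne (h ▸ rfl))).elim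

/-- If nonadjacent, `f` and `f'` would have as common neighbours an edge on the left side and a
right vertex with a third index, giving a paraglider. -/
theorem IsMatchedPair.adj_of_complete (hpara : ParagliderFree G) (hk : 3 ≤ k)
    (M : IsMatchedPair G a b) {f f' : V} (hf : ∀ h ∈ pairSet a b, G.Adj f h)
    (hf' : ∀ h ∈ pairSet a b, G.Adj f' h) (hne : f ≠ f') : G.Adj f f' := by
  by_contra h
  obtain ⟨l, h0, h1⟩ := exists_ne_ne hk ⟨0, by omega⟩ ⟨1, by omega⟩
  have := hpara.adj_or_adj (p := a ⟨0, by omega⟩) (q := a ⟨1, by omega⟩) (t := b l) hne h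
    (M.adj_left (by simp)) (hf _ (left_mem_pairSet _)) (hf _ (left_mem_pairSet _))
    (hf _ (right_mem_pairSet _)) (hf' _ (left_mem_pairSet _)) (hf' _ (left_mem_pairSet _))
    (hf' _ (right_mem_pairSet _))
  exact this.elim (M.not_adj' h0) (M.not_adj' h1)

theorem IsMatchedPair.cons (M : IsMatchedPair G a b) {x y : V} (hx : x ∉ pairSet a b)
    (hy : y ∉ pairSet a b) (hxy : G.Adj x y) (hxa : ∀ i, G.Adj x (a i))
    (hyb : ∀ i, G.Adj y (b i)) (hxb : ∀ i, ¬ G.Adj x (b i)) (hya : ∀ i, ¬ G.Adj y (a i)) :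
    IsMatchedPair G (Fin.cons x a : Fin (k + 1) → V) (Fin.cons y b) where
  adj_left := by
    intro i j
    cases i using Fin.cases <;> cases j using Fin.cases
    · simp
    · simp [hxa]
    · simp [(hxa _).symm]
    · simpa using M.adj_left
  adj_right := by
    intro i j
    cases i using Fin.cases <;> cases j using Fin.cases
    · simp
    · simp [hyb]
    · simp [(hyb _).symm]
    · simpa using M.adj_right
  ne := by
    intro i j
    cases i using Fin.cases <;> cases j using Fin.cases
    · simpa using hxy.ne
    · intro h
      simp only [Fin.cons_zero, Fin.cons_succ] at h
      exact hx (h ▸ right_mem_pairSet _)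
    · intro h
      simp only [Fin.cons_zero, Fin.cons_succ] at h
      exact hy (h ▸ left_mem_pairSet _)
    · simpa using M.ne _ _
  adj := by
    intro i
    cases i using Fin.cases
    · simpa
    · simpa using M.adj _
  not_adj := by
    intro i j
    cases i using Fin.cases <;> cases j using Fin.cases
    · simp
    · simp [hxb]
    · simp [G.adj_comm, hya]
    · simpa using M.not_adj

end MatchedPair

/-! ### Paths attached to a matched pair, clique separators and the conclusion. -/

section Attachment

variable {k : ℕ} {a b : Fin k → V}

/-- A chordless path outside a matched pair whose ends see two nonadjacent vertices of the pair,
while no proper subpath does so, consists of two vertices that extend the matched pair. -/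
theorem IsMatchedPair.exists_larger (hhole : HoleFree G) (hk : 3 ≤ k) (M : IsMatchedPair G a b)
    {d : ℕ} (hd : 1 ≤ d) {p : ℕ → V} (hp : IsInducedPath G (d + 1) p)
    (hX : ∀ t ≤ d, p t ∉ pairSet a b)
    (hmin : ∀ s t, s ≤ t → t ≤ d → (0 < s ∨ t < d) → ∀ u ∈ pairSet a b, ∀ v ∈ pairSet a b,
      u ≠ v → G.Adj (p s) u → G.Adj (p t) v → G.Adj u v)
    {i j : Fin k} (hij : i ≠ j) (hi : G.Adj (p 0) (a i)) (hj : G.Adj (p d) (b j)) :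
    ∃ a' b' : Fin (k + 1) → V, IsMatchedPair G a' b' := by
  have hpa : ∀ l, ∀ t ≤ d, p t ≠ a l := fun l t ht h => hX t ht (h ▸ left_mem_pairSet l)
  have hpb : ∀ l, ∀ t ≤ d, p t ≠ b l := fun l t ht h => hX t ht (h ▸ right_mem_pairSet l)
  have hmin' : ∀ s t, s ≤ d → t ≤ d → (0 < s ∧ 0 < t ∨ s < d ∧ t < d) → ∀ l m, l ≠ m →
      G.Adj (p s) (a l) → ¬ G.Adj (p t) (b m) := by
    intro s t hs ht hst l m hlm hsl htm
    rcases le_total s t with h | h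
    · exact M.not_adj hlm (hmin s t h ht (by omega) _ (left_mem_pairSet l) _
        (right_mem_pairSet m) (M.ne l m) hsl htm)
    · exact M.not_adj hlm (hmin t s h hs (by omega) _ (right_mem_pairSet m) _
        (left_mem_pairSet l) (M.ne l m).symm htm hsl).symm
  have h1 : ∀ s < d, ∀ t < d, ∀ l m, l ≠ m → G.Adj (p s) (a l) → ¬ G.Adj (p t) (b m) :=
    fun s hs t ht => hmin' s t hs.le ht.le (Or.inr ⟨hs, ht⟩)
  have h2 : ∀ s, 0 < s → s ≤ d → ∀ t, 0 < t → t ≤ d → ∀ l m, l ≠ m →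
      G.Adj (p s) (a l) → ¬ G.Adj (p t) (b m) :=
    fun s hs hs' t ht ht' => hmin' s t hs' ht' (Or.inl ⟨hs, ht⟩)
  have hai : ∀ t, 0 < t → t ≤ d → ¬ G.Adj (p t) (a i) :=
    fun t h0 ht h => h2 t h0 ht d hd le_rfl i j hij h hj
  have hbj : ∀ t < d, ¬ G.Adj (p t) (b j) := fun t ht h => h1 0 hd t ht i j hij hi h
  -- Otherwise the path closes to a hole through `b j, b i, a i`; similarly below through `b j, a j,
  -- a i`, and through `b j, b l, a l, a i` for a third index.
  obtain ⟨s, hs, hsb⟩ : ∃ s ≤ d, G.Adj (p s) (b i) := by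
    by_contra! h
    exact hp.not_closes_two hhole hd hj (M.adj_right hij.symm) (M.adj i).symm hi (hpb j) (hpb i)
      (hpa i) (M.not_adj' hij.symm) hbj h hai
  obtain ⟨t, ht, hta⟩ : ∃ t ≤ d, G.Adj (p t) (a j) := by
    by_contra! h
    exact hp.not_closes_two hhole hd hj (M.adj j).symm (M.adj_left hij.symm) hi (hpb j) (hpa j)
      (hpa i) (M.not_adj' hij.symm) hbj h hai
  have h3 : ∀ l, l ≠ i → l ≠ j → ∃ r ≤ d, G.Adj (p r) (a l) ∨ G.Adj (p r) (b l) := by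
    intro l hli hlj
    by_contra! h
    exact hp.not_closes_three hhole hd hj (M.adj_right hlj.symm) (M.adj l).symm (M.adj_left hli)
      hi (hpb j) (hpb l) (hpa l) (hpa i) (M.not_adj' hij.symm) (M.not_adj' hli)
      (M.not_adj' hlj.symm) hbj (fun r hr => (h r hr).2) (fun r hr => (h r hr).1) hai
  -- If `s < d`, then `t > 0`. Wherever the path sees `a l` or `b l` for a third `l`, that contact
  -- and one already known lie on a proper subpath and reach nonadjacent vertices, against
  -- minimality.
  have hsd : s = d := by
    by_contra hsd
    have hsd : s < d := lt_of_le_of_ne hs hsd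
    have ht0 : 0 < t := by
      by_contra h
      exact h1 t (by omega) s hsd j i hij.symm hta hsb
    obtain ⟨l, hli, hlj⟩ := exists_ne_ne hk i j
    obtain ⟨r, hr, hrl | hrl⟩ := h3 l hli hlj
    · rcases hr.eq_or_lt with rfl | hr'
      · exact h2 r hd le_rfl r hd le_rfl l j hlj hrl hj
      · exact h1 r hr' s hsd l i hli hrl hsb
    · rcases hr.eq_or_lt with rfl | hr'
      · exact h2 t ht0 ht r hd le_rfl j l hlj.symm hta hrl
      · exact h1 0 hd r hr' i l hli.symm hi hrl
  rw [hsd] at hsb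
  have ht0 : t = 0 := by
    by_contra h0
    exact h2 t (by omega) ht d hd le_rfl j i hij.symm hta hsb
  rw [ht0] at hta
  -- Only `p 0` can see the left side and only `p d` the right side; by `hab`, both see their entire
  -- side.
  have ha : ∀ l r, 0 < r → r ≤ d → ¬ G.Adj (p r) (a l) := by
    intro l r h0 hr h
    by_cases hli : l = i
    · exact hai r h0 hr (hli ▸ h)
    · exact h2 r h0 hr d hd le_rfl l i hli h hsb
  have hb : ∀ l, ∀ r < d, ¬ G.Adj (p r) (b l) := by
    intro l r hr h
    by_cases hli : l = i
    · exact h1 0 hd r hr j l (hli ▸ hij.symm) hta h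
    · exact h1 0 hd r hr i l (Ne.symm hli) hi h
  have hab : ∀ l, G.Adj (p 0) (a l) ∧ G.Adj (p d) (b l) := by
    intro l
    by_cases hli : l = i
    · exact hli ▸ ⟨hi, hsb⟩
    by_cases hlj : l = j
    · exact hlj ▸ ⟨hta, hj⟩
    by_cases hla : G.Adj (p 0) (a l)
    · refine ⟨hla, ?_⟩
      by_contra hlb
      refine hp.not_closes_two hhole hd hsb (M.adj_right (Ne.symm hli)) (M.adj l).symm hla (hpb i)
        (hpb l) (hpa l) (M.not_adj' (Ne.symm hli)) (hb i) ?_ (ha l)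
      intro r hr
      rcases hr.eq_or_lt with rfl | hr
      exacts [hlb, hb l r hr]
    · have hna : ∀ r ≤ d, ¬ G.Adj (p r) (a l) := by
        intro r hr
        rcases Nat.eq_zero_or_pos r with rfl | h0
        exacts [hla, ha l r h0 hr]
      have hlb : G.Adj (p d) (b l) := by
        obtain ⟨r, hr, h | h⟩ := h3 l hli hlj
        · exact (hna r hr h).elim
        · rcases hr.eq_or_lt with rfl | hr
          exacts [h, (hb l r hr h).elim]
      exact (hp.not_closes_two hhole hd hlb (M.adj l).symm (M.adj_left hli) hi (hpb l) (hpa l)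
        (hpa i) (M.not_adj' hli) (hb l) hna hai).elim
  -- For `d ≥ 2` the path closes to a hole through `b i, a i`.
  have hd1 : d = 1 := by
    by_contra hd1
    exact hp.not_closes_one hhole (by omega) hsb (M.adj i).symm hi (hpb i) (hpa i) (hb i) hai
  subst hd1
  exact ⟨_, _, M.cons (hX 0 (by omega)) (hX 1 le_rfl) ((hp 0 1 one_pos (by omega)).2.2 rfl)
    (fun l => (hab l).1) (fun l => (hab l).2) (fun l => hb l 0 one_pos)
    (fun l => ha l 1 one_pos le_rfl)⟩

/-- The neighbours, in a maximal matched pair, of a connected set of outer vertices form a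
clique. -/
theorem IsMatchedPair.adj_of_reachable (hhole : HoleFree G) (hpara : ParagliderFree G)
    (hk : 3 ≤ k) (M : IsMatchedPair G a b)
    (hmax : ¬ ∃ a' b' : Fin (k + 1) → V, IsMatchedPair G a' b') {x y : outerSet G a b}
    (hxy : (G.induce (outerSet G a b)).Reachable x y) {u v : V} (hu : u ∈ pairSet a b)
    (hv : v ∈ pairSet a b) (hne : u ≠ v) (hxu : G.Adj x u) (hyv : G.Adj y v) : G.Adj u v := by
  -- Proper subpaths of a geodesic have smaller distance, so the induction hypothesis is the
  -- minimality that `IsMatchedPair.exists_larger` asks for.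
  induction hn : (G.induce (outerSet G a b)).dist x y using Nat.strong_induction_on
    generalizing x y u v with
  | _ n ih =>
  by_contra huv
  obtain ⟨q, hq0, hqd, hq, hdist⟩ := exists_geodesic hxy
  rw [hn] at hqd hq hdist
  have hp : IsInducedPath G (n + 1) (fun t => (q t : V)) := by
    intro i j hij hj
    obtain ⟨h, h'⟩ := hq i j hij hj
    exact ⟨fun h'' => h (Subtype.ext h''), h'⟩
  have hmin : ∀ s t, s ≤ t → t ≤ n → (0 < s ∨ t < n) → ∀ u ∈ pairSet a b, ∀ v ∈ pairSet a b,
      u ≠ v → G.Adj (q s) u → G.Adj (q t) v → G.Adj u v := by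
    intro s t hst ht hlt u hu v hv hne hsu htv
    obtain ⟨hr, hd⟩ := hdist s t hst ht
    exact ih (t - s) (by omega) hr hu hv hne hsu htv hd
  have hX : ∀ t, (q t : V) ∉ pairSet a b := fun t => (q t).2.1
  have hn1 : 1 ≤ n := by
    by_contra h
    obtain rfl : n = 0 := by omega
    obtain rfl : x = y := hq0.symm.trans hqd
    obtain ⟨i, j, hij, ⟨rfl, rfl⟩ | ⟨rfl, rfl⟩⟩ := M.exists_of_not_adj hu hv hne huv
    · exact M.not_adj_of_mem_outerSet hhole hpara hk x.2 hij hxu hyv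
    · exact M.not_adj_of_mem_outerSet hhole hpara hk x.2 hij.symm hyv hxu
  rw [← hq0] at hxu
  rw [← hqd] at hyv
  obtain ⟨i, j, hij, ⟨rfl, rfl⟩ | ⟨rfl, rfl⟩⟩ := M.exists_of_not_adj hu hv hne huv
  · exact hmax (M.exists_larger hhole hk hn1 hp (fun t _ => hX t) hmin hij hxu hyv)
  · rw [pairSet_comm a b] at hX hmin
    exact hmax (M.swap.exists_larger hhole hk hn1 hp (fun t _ => hX t) hmin hij hxu hyv)

/-- The separator `K` is the neighbourhood of the component `C` of `x` among the outer vertices. It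
is a clique, the pair is not, so some vertex of the pair survives in `G - K`, where it is cut off
from `x`. -/
theorem IsMatchedPair.exists_isCliqueSeparator (hhole : HoleFree G) (hpara : ParagliderFree G)
    (hconn : G.Connected) (hk : 3 ≤ k) (M : IsMatchedPair G a b)
    (hmax : ¬ ∃ a' b' : Fin (k + 1) → V, IsMatchedPair G a' b') {x : V}
    (hx : x ∈ outerSet G a b) : ∃ K : Set V, IsCliqueSeparator G K := by
  set C : Set V := {v | ∃ hv : v ∈ outerSet G a b,
    (G.induce (outerSet G a b)).Reachable ⟨x, hx⟩ ⟨v, hv⟩} with hC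
  set K : Set V := {v | v ∉ outerSet G a b ∧ ∃ c ∈ C, G.Adj c v} with hK
  have hcompl : ∀ {v}, v ∉ outerSet G a b → v ∉ pairSet a b → ∀ h ∈ pairSet a b, G.Adj v h := by
    intro v hv hv'
    by_contra h
    exact hv ⟨hv', h⟩
  have hclique : G.IsClique K := by
    rintro u ⟨hu, c, ⟨hcX, hc⟩, hcu⟩ v ⟨hv, c', ⟨hcX', hc'⟩, hcv⟩ hne
    by_cases hu' : u ∈ pairSet a b
    · by_cases hv' : v ∈ pairSet a b
      · exact M.adj_of_reachable hhole hpara hk hmax (hc.symm.trans hc') hu' hv' hne hcu hcv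
      · exact (hcompl hv hv' u hu').symm
    · by_cases hv' : v ∈ pairSet a b
      · exact hcompl hu hu' v hv'
      · exact M.adj_of_complete hpara hk (hcompl hu hu') (hcompl hv hv') hne
  have hxK : x ∉ K := fun h => h.1 hx
  have h01 : (⟨0, by omega⟩ : Fin k) ≠ ⟨1, by omega⟩ := by simp
  obtain ⟨h, hh, hhK⟩ : ∃ h ∈ pairSet a b, h ∉ K := by
    by_contra! hsub
    exact M.not_adj h01 (hclique (hsub _ (left_mem_pairSet _)) (hsub _ (right_mem_pairSet _))
      (M.ne _ _))
  refine ⟨K, hclique, ?_⟩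
  have hclosed : ∀ u v : ↥(Kᶜ), (G.induce Kᶜ).Reachable u v → (u : V) ∈ C → (v : V) ∈ C := by
    rintro u v ⟨w⟩ hu
    induction w with
    | nil => exact hu
    | @cons u w' v huw _ ih =>
      refine ih ?_
      have huw : G.Adj u w' := huw
      obtain ⟨huX, hur⟩ := hu
      by_cases hw : (w' : V) ∈ outerSet G a b
      · exact ⟨hw, hur.trans (SimpleGraph.Adj.reachable (by exact huw))⟩
      · exact (w'.2 ⟨hw, u, ⟨huX, hur⟩, huw⟩).elim
  have hnontriv : Nontrivial (G.induce Kᶜ).ConnectedComponent := by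
    refine ⟨(G.induce Kᶜ).connectedComponentMk ⟨x, hxK⟩,
      (G.induce Kᶜ).connectedComponentMk ⟨h, hhK⟩, fun heq => ?_⟩
    have := hclosed _ _ (SimpleGraph.ConnectedComponent.exact heq) ⟨hx, .rfl⟩
    exact this.1.1 hh
  have hsub : Subsingleton G.ConnectedComponent :=
    hconn.preconnected.subsingleton_connectedComponent
  exact lt_of_le_of_lt (ENat.card_le_one_iff_subsingleton _ |>.2 hsub)
    (ENat.one_lt_card_iff_nontrivial _ |>.2 hnontriv)

theorem IsMatchedPair.isMatchedCoBipartite (hk : 1 ≤ k) (M : IsMatchedPair G a b) :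
    IsMatchedCoBipartite (G.induce (pairSet a b)) := by
  have ha : ∀ i j, a i = a j → i = j := fun i j h => by
    by_contra hij
    exact (M.adj_left hij).ne h
  have hb : ∀ i j, b i = b j → i = j := fun i j h => by
    by_contra hij
    exact (M.adj_right hij).ne h
  let f : Fin k ⊕ Fin k → pairSet a b :=
    Sum.elim (fun i => ⟨a i, left_mem_pairSet i⟩) (fun i => ⟨b i, right_mem_pairSet i⟩)
  have hf : Function.Bijective f := by
    constructor
    · rintro (i | i) (j | j) h <;> have h := congrArg Subtype.val h
      · exact congrArg _ (ha _ _ h)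
      · exact (M.ne _ _ h).elim
      · exact (M.ne _ _ h.symm).elim
      · exact congrArg _ (hb _ _ h)
    · rintro ⟨_, ⟨i, rfl⟩ | ⟨i, rfl⟩⟩
      exacts [⟨Sum.inl i, rfl⟩, ⟨Sum.inr i, rfl⟩]
  have hA : ∀ i j, G.Adj (a i) (a j) ↔ i ≠ j :=
    fun i j => ⟨fun h hij => h.ne (congrArg a hij), M.adj_left⟩
  have hB : ∀ i j, G.Adj (b i) (b j) ↔ i ≠ j :=
    fun i j => ⟨fun h hij => h.ne (congrArg b hij), M.adj_right⟩
  have hAB : ∀ i j, G.Adj (a i) (b j) ↔ i = j :=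
    fun i j => ⟨fun h => by by_contra hij; exact M.not_adj hij h, fun h => h ▸ M.adj i⟩
  refine ⟨k, hk, ⟨SimpleGraph.Iso.symm ⟨Equiv.ofBijective f hf, ?_⟩⟩⟩
  rintro (i | i) (j | j)
  · change G.Adj (a i) (a j) ↔ _
    simp [coMatchedBipartiteGraph, hA]
  · change G.Adj (a i) (b j) ↔ _
    simp [coMatchedBipartiteGraph, hAB]
  · change G.Adj (b i) (a j) ↔ _
    simp [coMatchedBipartiteGraph, G.adj_comm (b i), hAB]
  · change G.Adj (b i) (b j) ↔ _
    simp [coMatchedBipartiteGraph, hB]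

theorem exists_isMatchedPair_of_coC6 (h : coC6 ⊴ G) :
    ∃ a b : Fin 3 → V, IsMatchedPair G a b := by
  obtain ⟨f⟩ := h
  have hf : ∀ i j, G.Adj (f i) (f j) ↔ i ≠ j ∧ ¬ (i - j = 1 ∨ j - i = 1) := fun i j =>
    f.map_adj_iff.trans (by rw [coC6, SimpleGraph.compl_adj, SimpleGraph.cycleGraph_adj])
  -- Even and odd vertices form the two triangles; each vertex is matched with its antipode on the
  -- six-cycle.
  refine ⟨fun i => f (![0, 2, 4] i), fun i => f (![3, 5, 1] i), ?_, ?_, ?_, ?_, ?_⟩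
  · intro i j
    rw [hf]
    revert i j
    decide
  · intro i j
    rw [hf]
    revert i j
    decide
  · intro i j
    rw [f.injective.ne_iff]
    revert i j
    decide
  · intro i
    rw [hf]
    revert i
    decide
  · intro i j
    rw [hf]
    revert i j
    decide

theorem IsMatchedPair.le_card [Finite V] (M : IsMatchedPair G a b) : k ≤ Nat.card V := by
  have : Function.Injective a := fun i j h => by
    by_contra hij
    exact (M.adj_left hij).ne h
  simpa using Nat.card_le_card_of_injective a this

theorem isJoin_of_isAtomGraph [Finite V] (hhole : HoleFree G) (hpara : ParagliderFree G)
    (hconn : G.Connected) (hatom : IsAtomGraph G) (h6 : coC6 ⊴ G) :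
    IsJoinOfMatchedCoBipartiteAndClique G := by
  -- Sizes are bounded by `Nat.card V`, so extending from `k = 3` must stop.
  obtain ⟨k, ⟨hk, a, b, M⟩, hmax⟩ : ∃ k, (3 ≤ k ∧ ∃ a b : Fin k → V, IsMatchedPair G a b) ∧
      ¬ ∃ a b : Fin (k + 1) → V, IsMatchedPair G a b := by
    by_contra! h
    have all : ∀ n, ∃ a b : Fin (3 + n) → V, IsMatchedPair G a b := by
      intro n
      induction n with
      | zero => exact exists_isMatchedPair_of_coC6 h6
      | succ n ih =>
        obtain ⟨a, b, M⟩ := h (3 + n) ⟨by omega, ih⟩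
        exact ⟨a, b, M⟩
    obtain ⟨a, b, M⟩ := all (Nat.card V)
    have := M.le_card
    omega
  have hcompl : ∀ v, v ∉ pairSet a b → ∀ h ∈ pairSet a b, G.Adj v h := by
    intro v hv
    by_contra hv'
    exact hatom (M.exists_isCliqueSeparator hhole hpara hconn hk hmax ⟨hv, hv'⟩)
  exact ⟨pairSet a b, (pairSet a b)ᶜ, disjoint_compl_right, Set.union_compl_self _,
    fun x hx y hy => (hcompl y hy x hx).symm, M.isMatchedCoBipartite (by omega),
    fun u hu v hv hne => M.adj_of_complete hpara hk (hcompl u hu) (hcompl v hv) hne⟩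

end Attachment

end HPGraph

open scoped SimpleGraph in
theorem mainTheorem2 {V : Type*} [Finite V] (G : SimpleGraph V)
    (hhole : HPGraph.HoleFree G) (hpara : HPGraph.ParagliderFree G) :
    (∀ n : ℕ, 7 ≤ n → ¬ ((SimpleGraph.cycleGraph n)ᶜ ⊴ G)) ∧
    (¬ (HPGraph.coC6 ⊴ G) → HPGraph.WeaklyChordal G) ∧
    (G.Connected → HPGraph.IsAtomGraph G → HPGraph.coC6 ⊴ G →
      HPGraph.IsJoinOfMatchedCoBipartiteAndClique G) :=
  ⟨fun _ hn => hpara.not_isIndContained_antihole hn,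
    HPGraph.weaklyChordal_of_not_isIndContained_coC6 hhole hpara,
    HPGraph.isJoin_of_isAtomGraph hhole hpara⟩
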